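/- A complex unital transposed Poisson algebra is a unital commutative associative $\mathbb{C}$-algebra $(\mathbf{A},\cdot)$ with a Lie bracket $[\cdot,\cdot]$ (bilinear over $\mathbb{C}$) such that $2z\cdot[x,y]=[z\cdot x,y]+[x,z\cdot y]$ for all $x,y,z\in\mathbf{A}$. The map $\mathfrak{D}(x)=[x,1]$ is then a derivation of $(\mathbf{A},\cdot)$ with $[x,y]=\mathfrak{D}(x)\cdot y-x\cdot\mathfrak{D}(y)$; it is called the associated derivation. A polynomial identity of $\mathbf{A}$ is a nonzero element of the free complex unital transposed Poisson algebra on the variables $x_1,x_2,\ldots$ that vanishes under every substitution of elements of $\mathbf{A}$ for the variables. **Theorem.** If a complex unital transposed Poisson algebra $\mathbf{A}$ satisfies a polynomial identity, then there are an integer $m\geq 1$ and complex numbers $c_\sigma$ $(\sigma\in\mathbb{S}_m)$ such that both $$\mathfrak{g}(x_1,\ldots,x_m)=\sum_{\sigma\in\mathbb{S}_m}c_\sigma\,\mathfrak{D}(x_{\sigma(1)})\cdot\ldots\cdot\mathfrak{D}(x_{\sigma(m)})$$ and $$\mathfrak{f}(x_1,\ldots,x_{3m})=\sum_{\sigma\in\mathbb{S}_m}c_\sigma\prod_{k=1}^{m}\Big([x_{\sigma(k)}\cdot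 x_{m+2k-1},\,x_{m+2k}]+[x_{\sigma(k)}\cdot x_{m+2k},\,x_{m+2k-1}]\Big)$$ are polynomial identities of $\mathbf{A}$ (in particular, $\mathfrak{g}$ and $\mathfrak{f}$ are nonzero in the free algebra), where $\mathfrak{D}$ is the associated derivation. -/

import Mathlib

/-- A complex unital transposed Poisson algebra: a unital commutative associative `ℂ`-algebra
with a second bilinear operation `br` (the bracket `[x, y]`) which is a Lie bracket
and satisfies `2 z · [x, y] = [z · x, y] + [x, z · y]`. -/
class UnitalTransposedPoisson (A : Type*) [CommRing A] [Algebra ℂ A] where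
  br : A →ₗ[ℂ] A →ₗ[ℂ] A
  br_self : ∀ x : A, br x x = 0
  jacobi : ∀ x y z : A, br x (br y z) + br y (br z x) + br z (br x y) = 0
  transposed_leibniz : ∀ x y z : A, 2 * (z * br x y) = br (z * x) y + br x (z * y)

namespace UnitalTransposedPoisson

theorem two_cancel {B : Type*} [CommRing B] [Algebra ℂ B] {a b : B} (h : 2 * a = 2 * b) : a = b := by
  have h2 : (2 : ℂ) • a = (2 : ℂ) • b := by
    simpa [two_smul, two_mul] using h
  have h3 := congrArg (fun t => (2⁻¹ : ℂ) • t) h2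
  simpa [smul_smul] using h3

section

variable {A : Type*} [CommRing A] [Algebra ℂ A] [UnitalTransposedPoisson A]

theorem br_swap (x y : A) : br y x = -br x y := by
  have h := br_self (x + y)
  simp only [map_add, LinearMap.add_apply, br_self, zero_add, add_zero] at h
  exact eq_neg_of_add_eq_zero_left (by simpa [add_comm] using h)

theorem br_mul_one (x y : A) : br (x * y) 1 = x * br y 1 + br x 1 * y := by
  have h1 := transposed_leibniz x 1 y
  have h2 := transposed_leibniz y 1 x
  rw [mul_one] at h1 h2
  rw [br_swap x y] at h2
  rw [mul_comm y x] at h1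
  exact two_cancel (by linear_combination (-1 : A) * h1 - h2)

/-- The derivation associated with a unital transposed Poisson algebra, `D(x) = [x, 1]`. -/
noncomputable def D : Derivation ℂ A A :=
  Derivation.mk' (br.flip (1 : A)) (fun x y => by
    simp only [LinearMap.flip_apply, smul_eq_mul, br_mul_one]; ring)

theorem D_apply (x : A) : D x = br x 1 := rfl

/-- `D` is the derivation that describes the bracket: `[x, y] = D(x) y - x D(y)`. -/
theorem br_eq (x y : A) : br x y = D x * y - x * D y := by
  have h1 := transposed_leibniz x 1 y
  have h2 := transposed_leibniz y 1 x
  rw [mul_one] at h1 h2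
  rw [br_swap x y] at h2
  rw [mul_comm y x] at h1
  rw [D_apply, D_apply]
  exact two_cancel (by linear_combination (-1 : A) * h1 + h2)

end

/-! ### The free unital transposed Poisson algebra -/

/-- Formal expressions in the variables `X`, complex constants, sums, products and brackets. -/
inductive Pre (X : Type*)
  | var : X → Pre X
  | scalar : ℂ → Pre X
  | add : Pre X → Pre X → Pre X
  | mul : Pre X → Pre X → Pre X
  | br : Pre X → Pre X → Pre X

/-- The defining relations of unital transposed Poisson algebras on formal expressions,
closed under the operations. -/
inductive Rel (X : Type*) : Pre X → Pre X → Prop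
  | scalar_add (r s : ℂ) : Rel X (.scalar (r + s)) (.add (.scalar r) (.scalar s))
  | scalar_mul (r s : ℂ) : Rel X (.scalar (r * s)) (.mul (.scalar r) (.scalar s))
  | add_comm (a b : Pre X) : Rel X (.add a b) (.add b a)
  | add_assoc (a b c : Pre X) : Rel X (.add (.add a b) c) (.add a (.add b c))
  | zero_add (a : Pre X) : Rel X (.add (.scalar 0) a) a
  | mul_comm (a b : Pre X) : Rel X (.mul a b) (.mul b a)
  | mul_assoc (a b c : Pre X) : Rel X (.mul (.mul a b) c) (.mul a (.mul b c))
  | one_mul (a : Pre X) : Rel X (.mul (.scalar 1) a) a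
  | zero_mul (a : Pre X) : Rel X (.mul (.scalar 0) a) (.scalar 0)
  | mul_add (a b c : Pre X) : Rel X (.mul a (.add b c)) (.add (.mul a b) (.mul a c))
  | br_add_left (a b c : Pre X) : Rel X (.br (.add a b) c) (.add (.br a c) (.br b c))
  | br_add_right (a b c : Pre X) : Rel X (.br a (.add b c)) (.add (.br a b) (.br a c))
  | br_smul_left (r : ℂ) (a b : Pre X) :
      Rel X (.br (.mul (.scalar r) a) b) (.mul (.scalar r) (.br a b))
  | br_smul_right (r : ℂ) (a b : Pre X) :
      Rel X (.br a (.mul (.scalar r) b)) (.mul (.scalar r) (.br a b))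
  | br_self (a : Pre X) : Rel X (.br a a) (.scalar 0)
  | jacobi (a b c : Pre X) :
      Rel X (.add (.add (.br a (.br b c)) (.br b (.br c a))) (.br c (.br a b))) (.scalar 0)
  | transposed_leibniz (a b c : Pre X) :
      Rel X (.mul (.scalar 2) (.mul c (.br a b))) (.add (.br (.mul c a) b) (.br a (.mul c b)))
  | add_congr_left {a b : Pre X} (c : Pre X) : Rel X a b → Rel X (.add a c) (.add b c)
  | add_congr_right (a : Pre X) {b c : Pre X} : Rel X b c → Rel X (.add a b) (.add a c)
  | mul_congr_left {a b : Pre X} (c : Pre X) : Rel X a b → Rel X (.mul a c) (.mul b c)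
  | mul_congr_right (a : Pre X) {b c : Pre X} : Rel X b c → Rel X (.mul a b) (.mul a c)
  | br_congr_left {a b : Pre X} (c : Pre X) : Rel X a b → Rel X (.br a c) (.br b c)
  | br_congr_right (a : Pre X) {b c : Pre X} : Rel X b c → Rel X (.br a b) (.br a c)

/-- The free unital transposed Poisson algebra on the set `X` of variables. -/
def Free (X : Type*) : Type _ := Quot (Rel X)

namespace Free

section

variable {X : Type*}

/-- The class of a formal expression. -/
def mk (a : Pre X) : Free X := Quot.mk _ a

/-- A variable. -/
def var (x : X) : Free X := mk (.var x)

/-- The constants. -/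
def scalar (r : ℂ) : Free X := mk (.scalar r)

instance : Zero (Free X) := ⟨scalar 0⟩

instance : One (Free X) := ⟨scalar 1⟩

instance : Add (Free X) :=
  ⟨Quot.map₂ Pre.add (fun a _ _ => Rel.add_congr_right a) (fun _ _ c => Rel.add_congr_left c)⟩

instance : Mul (Free X) :=
  ⟨Quot.map₂ Pre.mul (fun a _ _ => Rel.mul_congr_right a) (fun _ _ c => Rel.mul_congr_left c)⟩

instance : Neg (Free X) := ⟨fun a => scalar (-1) * a⟩

/-- The bracket of the free algebra as a function. -/
def brFun : Free X → Free X → Free X :=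
  Quot.map₂ Pre.br (fun a _ _ => Rel.br_congr_right a) (fun _ _ c => Rel.br_congr_left c)

theorem scalar_add (r s : ℂ) : (scalar (r + s) : Free X) = scalar r + scalar s :=
  Quot.sound (Rel.scalar_add r s)

theorem scalar_mul (r s : ℂ) : (scalar (r * s) : Free X) = scalar r * scalar s :=
  Quot.sound (Rel.scalar_mul r s)

theorem add_comm' (a b : Free X) : a + b = b + a := by
  induction a using Quot.ind
  induction b using Quot.ind
  exact Quot.sound (Rel.add_comm _ _)

theorem mul_comm' (a b : Free X) : a * b = b * a := by
  induction a using Quot.ind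
  induction b using Quot.ind
  exact Quot.sound (Rel.mul_comm _ _)

theorem zero_add' (a : Free X) : 0 + a = a := by
  induction a using Quot.ind
  exact Quot.sound (Rel.zero_add _)

theorem one_mul' (a : Free X) : 1 * a = a := by
  induction a using Quot.ind
  exact Quot.sound (Rel.one_mul _)

theorem zero_mul' (a : Free X) : 0 * a = 0 := by
  induction a using Quot.ind
  exact Quot.sound (Rel.zero_mul _)

theorem add_assoc' (a b c : Free X) : a + b + c = a + (b + c) := by
  induction a using Quot.ind
  induction b using Quot.ind
  induction c using Quot.ind
  exact Quot.sound (Rel.add_assoc _ _ _)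

theorem mul_assoc' (a b c : Free X) : a * b * c = a * (b * c) := by
  induction a using Quot.ind
  induction b using Quot.ind
  induction c using Quot.ind
  exact Quot.sound (Rel.mul_assoc _ _ _)

theorem mul_add' (a b c : Free X) : a * (b + c) = a * b + a * c := by
  induction a using Quot.ind
  induction b using Quot.ind
  induction c using Quot.ind
  exact Quot.sound (Rel.mul_add _ _ _)

theorem neg_add' (a : Free X) : -a + a = 0 := by
  change scalar (-1) * a + a = 0
  have h : scalar (-1) * a + 1 * a = (scalar (-1) + scalar 1) * a := by
    rw [mul_comm' (scalar (-1) + scalar 1), mul_add', mul_comm' a, mul_comm' a]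
    rfl
  rw [one_mul', ← scalar_add, neg_add_cancel] at h
  rw [h]
  exact zero_mul' a

instance : CommRing (Free X) where
  add_assoc := add_assoc'
  zero_add := zero_add'
  add_zero a := by rw [add_comm', zero_add']
  add_comm := add_comm'
  nsmul := nsmulRec
  zsmul := zsmulRec
  neg_add_cancel := neg_add'
  mul_assoc := mul_assoc'
  mul_comm := mul_comm'
  one_mul := one_mul'
  mul_one a := by rw [mul_comm', one_mul']
  zero_mul := zero_mul'
  mul_zero a := by rw [mul_comm', zero_mul']
  left_distrib := mul_add'
  right_distrib a b c := by rw [mul_comm', mul_add', mul_comm' c, mul_comm' c]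

instance : Algebra ℂ (Free X) where
  smul r a := scalar r * a
  algebraMap :=
    { toFun := scalar
      map_one' := rfl
      map_mul' := scalar_mul
      map_zero' := rfl
      map_add' := scalar_add }
  commutes' _ _ := mul_comm _ _
  smul_def' _ _ := rfl

theorem smul_eq (r : ℂ) (a : Free X) : r • a = scalar r * a := rfl

instance : UnitalTransposedPoisson (Free X) where
  br := LinearMap.mk₂ ℂ brFun
    (by rintro ⟨a⟩ ⟨b⟩ ⟨c⟩; exact Quot.sound (Rel.br_add_left a b c))
    (by rintro r ⟨a⟩ ⟨b⟩; exact Quot.sound (Rel.br_smul_left r a b))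
    (by rintro ⟨a⟩ ⟨b⟩ ⟨c⟩; exact Quot.sound (Rel.br_add_right a b c))
    (by rintro r ⟨a⟩ ⟨b⟩; exact Quot.sound (Rel.br_smul_right r a b))
  br_self := by rintro ⟨a⟩; exact Quot.sound (Rel.br_self a)
  jacobi := by rintro ⟨a⟩ ⟨b⟩ ⟨c⟩; exact Quot.sound (Rel.jacobi a b c)
  transposed_leibniz := by
    rintro ⟨a⟩ ⟨b⟩ ⟨c⟩
    have h2 : (2 : Free X) = scalar 2 := by
      rw [← one_add_one_eq_two, ← one_add_one_eq_two, scalar_add]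
      rfl
    rw [h2]
    exact Quot.sound (Rel.transposed_leibniz a b c)

end

section

variable {X : Type*} {A : Type*} [CommRing A] [Algebra ℂ A] [UnitalTransposedPoisson A]

/-- The value of a formal expression in `A` when the variables take the values `v`. -/
noncomputable def evalPre (v : X → A) : Pre X → A
  | .var x => v x
  | .scalar r => algebraMap ℂ A r
  | .add a b => evalPre v a + evalPre v b
  | .mul a b => evalPre v a * evalPre v b
  | .br a b => UnitalTransposedPoisson.br (evalPre v a) (evalPre v b)

theorem evalPre_rel (v : X → A) {a b : Pre X} (h : Rel X a b) : evalPre v a = evalPre v b := by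
  induction h with
  | scalar_add r s => simp [evalPre]
  | scalar_mul r s => simp [evalPre]
  | add_comm a b => exact add_comm _ _
  | add_assoc a b c => exact add_assoc _ _ _
  | zero_add a => simp [evalPre]
  | mul_comm a b => exact mul_comm _ _
  | mul_assoc a b c => exact mul_assoc _ _ _
  | one_mul a => simp [evalPre]
  | zero_mul a => simp [evalPre]
  | mul_add a b c => exact mul_add _ _ _
  | br_add_left a b c => simp [evalPre]
  | br_add_right a b c => simp [evalPre]
  | br_smul_left r a b => simp [evalPre, ← Algebra.smul_def]
  | br_smul_right r a b => simp [evalPre, ← Algebra.smul_def]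
  | br_self a => simp [evalPre, UnitalTransposedPoisson.br_self]
  | jacobi a b c => simp [evalPre, UnitalTransposedPoisson.jacobi]
  | transposed_leibniz a b c =>
    simp only [evalPre, map_ofNat]
    exact UnitalTransposedPoisson.transposed_leibniz _ _ _
  | add_congr_left c _ ih => simp [evalPre, ih]
  | add_congr_right a _ ih => simp [evalPre, ih]
  | mul_congr_left c _ ih => simp [evalPre, ih]
  | mul_congr_right a _ ih => simp [evalPre, ih]
  | br_congr_left c _ ih => simp [evalPre, ih]
  | br_congr_right a _ ih => simp [evalPre, ih]

/-- Evaluation at `v`: the homomorphism of unital transposed Poisson algebras from the free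
algebra to `A` that takes each variable `x` to `v x`. -/
noncomputable def eval (v : X → A) : Free X →ₐ[ℂ] A where
  toFun := Quot.lift (evalPre v) (fun _ _ h => evalPre_rel v h)
  map_one' := map_one (algebraMap ℂ A)
  map_zero' := map_zero (algebraMap ℂ A)
  map_mul' := by rintro ⟨a⟩ ⟨b⟩; rfl
  map_add' := by rintro ⟨a⟩ ⟨b⟩; rfl
  commutes' _ := rfl

theorem eval_var (v : X → A) (x : X) : eval v (var x) = v x := rfl

theorem eval_br (v : X → A) (p q : Free X) :
    eval v (br p q) = br (eval v p) (eval v q) := by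
  obtain ⟨a⟩ := p
  obtain ⟨b⟩ := q
  rfl

/-- The universal property: `eval v` is the only such homomorphism. -/
theorem eval_unique (v : X → A) (φ : Free X →ₐ[ℂ] A)
    (hbr : ∀ p q : Free X, φ (br p q) = br (φ p) (φ q))
    (hvar : ∀ x, φ (var x) = v x) : φ = eval v := by
  ext p
  obtain ⟨a⟩ := p
  induction a with
  | var x => exact hvar x
  | scalar r => exact φ.commutes r
  | add a b ha hb => exact (map_add φ (mk a) (mk b)).trans (congrArg₂ (· + ·) ha hb)
  | mul a b ha hb => exact (map_mul φ (mk a) (mk b)).trans (congrArg₂ (· * ·) ha hb)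
  | br a b ha hb =>
    exact (hbr (mk a) (mk b)).trans
      (congrArg₂ (fun s t => UnitalTransposedPoisson.br s t) ha hb)

end

end Free

/-- Polynomials are the elements of the free unital transposed Poisson algebra on the
variables `x₀, x₁, x₂, …`. -/
abbrev Poly : Type := Free ℕ

/-- `p = 0` is a polynomial identity of `A`: the polynomial `p` is not zero, and it vanishes
under every substitution of elements of `A` for the variables. -/
def IsPolynomialIdentity (A : Type*) [CommRing A] [Algebra ℂ A] [UnitalTransposedPoisson A]
    (p : Poly) : Prop :=
  p ≠ 0 ∧ ∀ v : ℕ → A, Free.eval v p = 0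

/-- The polynomial `∑_σ c_σ D(x_{σ(1)}) ⋯ D(x_{σ(m)})`, where the variables are numbered from
`0`. -/
noncomputable def polyG (m : ℕ) (c : Equiv.Perm (Fin m) → ℂ) : Poly :=
  ∑ σ : Equiv.Perm (Fin m), c σ • ∏ k : Fin m, D (Free.var (σ k : ℕ) : Poly)

/-- The polynomial
`∑_σ c_σ ∏_{k=1}^m ([x_{σ(k)} · x_{m+2k-1}, x_{m+2k}] + [x_{σ(k)} · x_{m+2k}, x_{m+2k-1}])`
in `3m` variables, where `k` and the variables are numbered from `0`. -/
noncomputable def polyF (m : ℕ) (c : Equiv.Perm (Fin m) → ℂ) : Poly :=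
  ∑ σ : Equiv.Perm (Fin m), c σ • ∏ k : Fin m,
    (br (Free.var (σ k : ℕ) * Free.var (m + 2 * (k : ℕ)) : Poly)
        (Free.var (m + 2 * (k : ℕ) + 1))
      + br (Free.var (σ k : ℕ) * Free.var (m + 2 * (k : ℕ) + 1) : Poly)
        (Free.var (m + 2 * (k : ℕ))))

end UnitalTransposedPoisson

/-!
The free algebra embeds into the ring of differential polynomials, because a commutative algebra
with a derivation `D` is a unital transposed Poisson algebra under `[x, y] = D(x) y - x D(y)`. So
a polynomial identity of `A` is a nonzero polynomial `q` in variables `x_{i,k}` that vanishes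
whenever `x_{i,k} = D^k(v_i)` with `v_i` in `A`.

A polynomial over `A` that vanishes at all complex points is zero
(`eq_zero_of_forall_eval_algebraMap`). Hence the complex coefficients in a linear combination of
jets `(v, D v, D² v, …)` can be replaced by elements of `A`: the polynomial `q` vanishes on the whole
`A`-span of the jets (`aeval_eq_zero_of_mem_span`). For each `y` in `A`, the `A`-linear operator
that takes the jet of `e` to the jet of `y e` minus `y` times the jet of `e` is strictly lower
triangular with the entries `k D(y)` below the diagonal. Its iterates on the jet of `1` show that in the
first `n` coordinates the span contains `D(y)^N` times every vector, with `N = 0 + ⋯ + (n - 1)`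
(`exists_mem_jetSpan_eq`). So `q` vanishes at all points `(D(y)^N α_{i,k})` with complex
`α_{i,k}`, and again the coefficients must vanish: `D(y)^(N s) = 0` if `q` has a monomial of degree `s`
(`exists_forall_pow_eq_zero`). Polarization gives `D(x_1) ⋯ D(x_m) = 0` with `m = N s + 1`.

Since products commute, `𝔤` is `(∑ c_σ) D(x_1) ⋯ D(x_m)`, and
`[x y, z] + [x z, y] = 2 D(x) y z` shows that `𝔣` is a multiple of `𝔤`. Both are nonzero as soon as
`∑ c_σ ≠ 0`.
-/

namespace UnitalTransposedPoisson

open MvPolynomial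

/-! ### Polynomials over a complex algebra that vanish at complex points -/

/-- Applying a `ℂ`-linear functional of `A` to the coefficients reduces this to complex
polynomials. -/
theorem eq_zero_of_forall_eval_algebraMap {A σ : Type*} [CommRing A] [Algebra ℂ A]
    (F : MvPolynomial σ A)
    (h : ∀ α : σ → ℂ, MvPolynomial.eval (fun i => algebraMap ℂ A (α i)) F = 0) :
    F = 0 := by
  classical
  ext s
  rw [coeff_zero, ← Module.forall_dual_apply_eq_zero_iff ℂ]
  intro φ
  let G : MvPolynomial σ ℂ := ∑ t ∈ F.support, monomial t (φ (coeff t F))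
  have hG : G = 0 := by
    refine MvPolynomial.funext fun α => ?_
    have h1 := congrArg φ (h α)
    rw [MvPolynomial.eval_eq, map_sum, map_zero] at h1
    rw [map_zero, map_sum, ← h1]
    refine Finset.sum_congr rfl fun t _ => ?_
    rw [eval_monomial, Finsupp.prod]
    simp_rw [← map_pow, ← map_prod]
    rw [mul_comm (coeff t F), ← Algebra.smul_def, map_smul, smul_eq_mul, mul_comm]
  have h2 := congrArg (coeff s) hG
  simp only [G, coeff_sum, coeff_monomial, coeff_zero, Finset.sum_ite_eq'] at h2
  by_cases hs : s ∈ F.support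
  · simpa [hs] using h2
  · rw [notMem_support_iff.mp hs, map_zero]

/-- A complex polynomial that vanishes on a complex subspace `V` of `σ → A` vanishes on the
`A`-submodule that `V` generates. -/
theorem aeval_eq_zero_of_mem_span {A σ : Type*} [CommRing A] [Algebra ℂ A]
    (q : MvPolynomial σ ℂ) (V : Submodule ℂ (σ → A)) (h : ∀ u ∈ V, aeval u q = 0)
    (u : σ → A) (hu : u ∈ Submodule.span A (V : Set (σ → A))) : aeval u q = 0 := by
  obtain ⟨n, a, v, rfl⟩ := Submodule.mem_span_set'.mp hu
  -- `F` is the value of `q` at the linear combination of the `v i` with indeterminate coefficients.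
  let F : MvPolynomial (Fin n) A :=
    aeval (fun s => ∑ i, X i * C ((v i : σ → A) s)) q
  have key : ∀ b : Fin n → A,
      MvPolynomial.eval b F = aeval (∑ i, b i • (v i : σ → A)) q := by
    intro b
    have : (MvPolynomial.aeval b : MvPolynomial (Fin n) A →ₐ[A] A).restrictScalars ℂ F
        = aeval (∑ i, b i • (v i : σ → A)) q := by
      simp only [F]
      rw [← AlgHom.comp_apply, comp_aeval]
      congr 2
      funext s
      simp [Finset.sum_apply]
    rw [← this]
    rfl
  have hF : F = 0 := by
    refine eq_zero_of_forall_eval_algebraMap F fun α => ?_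
    rw [key]
    refine h _ (Submodule.sum_mem _ fun i _ => ?_)
    have : (algebraMap ℂ A (α i)) • (v i : σ → A) = α i • (v i : σ → A) := by
      ext s
      simp [Algebra.smul_def]
    rw [this]
    exact V.smul_mem _ (v i).2
  rw [← key, hF, map_zero]

/-! ### Jets -/

section Jets

variable {A : Type*} [CommRing A] [Algebra ℂ A] (δ : Derivation ℂ A A)

theorem iterate_derivation_mul (n : ℕ) (x y : A) :
    δ^[n] (x * y) =
      ∑ p ∈ Finset.HasAntidiagonal.antidiagonal n, n.choose p.1 • (δ^[p.1] x * δ^[p.2] y) := by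
  induction n with
  | zero => simp
  | succ n ih =>
    rw [Function.iterate_succ_apply', ih, map_sum,
      Finset.sum_antidiagonal_choose_succ_nsmul (fun i j => δ^[i] x * δ^[j] y) n,
      ← Finset.sum_add_distrib]
    refine Finset.sum_congr rfl fun p hp => ?_
    have hc : n.choose p.2 = n.choose p.1 :=
      (Nat.choose_symm_of_eq_add (Finset.HasAntidiagonal.mem_antidiagonal.mp hp).symm).symm
    rw [hc, map_nsmul, Derivation.leibniz, ← smul_add, Function.iterate_succ_apply',
      Function.iterate_succ_apply', smul_eq_mul, smul_eq_mul, mul_comm (δ^[p.2] y)]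

/-- The `A`-submodule of `ℕ → A` generated by the jets `(e, δ e, δ² e, …)` of all `e : A`. -/
def jetSpan : Submodule A (ℕ → A) :=
  Submodule.span A (Set.range fun e : A => fun k => δ^[k] e)

/-- The `A`-linear operator on `ℕ → A` that takes the jet of each `e` to the jet of `y * e`
minus `y` times the jet of `e`. -/
def jetShift (y : A) : (ℕ → A) →ₗ[A] (ℕ → A) where
  toFun u := fun k =>
    ∑ p ∈ Finset.HasAntidiagonal.antidiagonal k, k.choose p.1 • (δ^[p.1] y * u p.2) - y * u k
  map_add' u v := by
    funext k
    simp only [Pi.add_apply, mul_add, smul_add, Finset.sum_add_distrib]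
    ring
  map_smul' a u := by
    funext k
    simp only [Pi.smul_apply, smul_eq_mul, RingHom.id_apply, mul_sub, Finset.mul_sum,
      nsmul_eq_mul]
    congr 1
    · exact Finset.sum_congr rfl fun p _ => by ring
    · ring

theorem jetShift_apply_zero (y : A) (u : ℕ → A) : jetShift δ y u 0 = 0 := by
  simp [jetShift]

theorem jetShift_apply_succ (y : A) (u : ℕ → A) (k : ℕ) :
    jetShift δ y u (k + 1) = ∑ p ∈ Finset.HasAntidiagonal.antidiagonal k,
      (k + 1).choose (p.1 + 1) • (δ^[p.1 + 1] y * u p.2) := by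
  simp [jetShift, Finset.Nat.sum_antidiagonal_succ]

theorem jetShift_mem (y : A) {u : ℕ → A} (hu : u ∈ jetSpan δ) :
    jetShift δ y u ∈ jetSpan δ := by
  suffices jetSpan δ ≤ (jetSpan δ).comap (jetShift δ y) from this hu
  refine Submodule.span_le.mpr ?_
  rintro _ ⟨e, rfl⟩
  have : jetShift δ y (fun k => δ^[k] e)
      = (fun k => δ^[k] (y * e)) - y • (fun k => δ^[k] e) := by
    funext k
    simp [jetShift, iterate_derivation_mul]
  simp only [SetLike.mem_coe, Submodule.mem_comap]
  rw [this]
  exact sub_mem (Submodule.subset_span ⟨_, rfl⟩)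
    (Submodule.smul_mem _ _ (Submodule.subset_span ⟨_, rfl⟩))

/-- The `l`-th iterate of `jetShift δ y` takes the jet of `1` to a vector with these entries. -/
theorem exists_mem_jetSpan_leading (y : A) (l : ℕ) :
    ∃ u ∈ jetSpan δ, (∀ k < l, u k = 0) ∧ u l = (l.factorial : A) * δ y ^ l := by
  induction l with
  | zero => exact ⟨_, Submodule.subset_span ⟨1, rfl⟩, by simp, by simp⟩
  | succ l ih =>
    obtain ⟨u, hu, h0, hl⟩ := ih
    refine ⟨jetShift δ y u, jetShift_mem δ y hu, ?_, ?_⟩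
    · rintro (_ | k) hk
      · exact jetShift_apply_zero δ y u
      · rw [jetShift_apply_succ]
        refine Finset.sum_eq_zero fun p hp => ?_
        rw [h0 p.2 (by have := Finset.HasAntidiagonal.mem_antidiagonal.mp hp; omega), mul_zero, smul_zero]
    · rw [jetShift_apply_succ, Finset.sum_eq_single (0, l)]
      · simp [hl, Nat.factorial_succ]
        ring
      · rintro ⟨i, j⟩ hp hne
        have hij := Finset.HasAntidiagonal.mem_antidiagonal.mp hp
        have : j < l := by
          rcases Nat.eq_zero_or_pos i with rfl | hi
          · exact absurd (by simpa using hij) (by simpa using hne)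
          · simp only at hij
            omega
        rw [h0 j this, mul_zero, smul_zero]
      · simp

/-- Gaussian elimination in the first `n` coordinates: every vector becomes congruent to a
combination of jets after multiplication by a power of `δ y` that depends only on `n`. -/
theorem exists_mem_jetSpan_eq (y : A) (n : ℕ) (g : ℕ → A) :
    ∃ u ∈ jetSpan δ, ∀ k < n, u k = δ y ^ (∑ i ∈ Finset.range n, i) * g k := by
  induction n with
  | zero => exact ⟨0, zero_mem _, by simp⟩
  | succ n ih =>
    obtain ⟨u, hu, h⟩ := ih
    obtain ⟨t, ht, h0, hn⟩ := exists_mem_jetSpan_leading δ y n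
    -- The multiple of `t` corrects the entry at `n` and leaves the earlier entries alone.
    refine ⟨δ y ^ n • u + (algebraMap ℂ A (n.factorial : ℂ)⁻¹
        * (δ y ^ (∑ i ∈ Finset.range n, i) * g n - u n)) • t,
      add_mem (Submodule.smul_mem _ _ hu) (Submodule.smul_mem _ _ ht), fun k hk => ?_⟩
    have hinv : algebraMap ℂ A (n.factorial : ℂ)⁻¹ * (n.factorial : A) = 1 := by
      rw [← map_natCast (algebraMap ℂ A), ← map_mul,
        inv_mul_cancel₀ (Nat.cast_ne_zero.mpr n.factorial_ne_zero), map_one]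
    simp only [Pi.add_apply, Pi.smul_apply, smul_eq_mul, Finset.sum_range_succ, pow_add]
    rcases Nat.lt_succ_iff_lt_or_eq.mp hk with hk | rfl
    · rw [h k hk, h0 k hk]
      ring
    · rw [hn]
      linear_combination
        ((δ y ^ (∑ i ∈ Finset.range k, i) * g k - u k) * δ y ^ k) * hinv

/-- A nonzero differential polynomial `q` (the variable `(i, k)` stands for the `k`-th derivative
of the `i`-th argument) that vanishes identically on `A` makes the values of `δ` nilpotent of
bounded index. -/
theorem exists_forall_pow_eq_zero (q : MvPolynomial (ℕ × ℕ) ℂ) (hq : q ≠ 0)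
    (h : ∀ v : ℕ → A, aeval (fun p : ℕ × ℕ => δ^[p.2] (v p.1)) q = 0) :
    ∃ m : ℕ, 0 < m ∧ ∀ y : A, δ y ^ m = 0 := by
  obtain ⟨s, hs⟩ := MvPolynomial.ne_zero_iff.mp hq
  obtain ⟨n, hn⟩ : ∃ n : ℕ, ∀ p ∈ q.vars, p.2 < n :=
    ⟨q.vars.sup Prod.snd + 1, fun p hp => Nat.lt_succ_of_le (Finset.le_sup (f := Prod.snd) hp)⟩
  refine ⟨(∑ i ∈ Finset.range n, i) * s.degree + 1, Nat.succ_pos _, fun y => ?_⟩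
  set d := δ y ^ (∑ i ∈ Finset.range n, i) with hd
  let V : Submodule ℂ (ℕ × ℕ → A) :=
    { carrier := Set.range fun v : ℕ → A => fun p : ℕ × ℕ => δ^[p.2] (v p.1)
      add_mem' := by
        rintro _ _ ⟨v, rfl⟩ ⟨w, rfl⟩
        exact ⟨v + w, by funext p; simp [iterate_map_add]⟩
      zero_mem' := ⟨0, by funext p; simp [iterate_map_zero]⟩
      smul_mem' := by
        rintro c _ ⟨v, rfl⟩
        refine ⟨c • v, ?_⟩
        funext p
        simp [← Derivation.coeFn_coe, ← Module.End.pow_apply] }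
  have hV := aeval_eq_zero_of_mem_span q V (by rintro _ ⟨v, rfl⟩; exact h v)
  -- Place a combination of jets in every argument, with the complex weight `α i` in the `i`-th one.
  have hplace : ∀ (α : ℕ → ℂ) (u : ℕ → A), u ∈ jetSpan δ →
      (fun p : ℕ × ℕ => algebraMap ℂ A (α p.1) * u p.2)
        ∈ Submodule.span A (V : Set (ℕ × ℕ → A)) := by
    intro α u hu
    induction hu using Submodule.span_induction with
    | mem u hu =>
      obtain ⟨e, rfl⟩ := hu
      refine Submodule.subset_span ⟨fun i => α i • e, ?_⟩
      funext p
      simp only [← Derivation.coeFn_coe, ← Module.End.pow_apply, map_smul]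
      rw [Algebra.smul_def]
    | zero =>
      convert zero_mem (Submodule.span A (V : Set (ℕ × ℕ → A))) using 1
      funext p
      simp
    | add u w _ _ hu hw =>
      convert add_mem hu hw using 1
      funext p
      simp [mul_add]
    | smul a u _ hu =>
      convert Submodule.smul_mem _ a hu using 1
      funext p
      simp [mul_left_comm]
  have hzero : ∀ α : ℕ × ℕ → ℂ, aeval (fun p => d * algebraMap ℂ A (α p)) q = 0 := by
    intro α
    choose u hu hu' using fun k : ℕ => exists_mem_jetSpan_eq δ y n (Pi.single k 1)
    have := hV _ (Submodule.sum_mem (t := Finset.range n) _ fun k _ =>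
      hplace (fun i => α (i, k)) (u k) (hu k))
    rw [← this]
    refine eval₂Hom_congr' rfl (fun p hp _ => ?_) rfl
    rw [Finset.sum_apply, Finset.sum_eq_single p.2]
    · rw [hu' _ _ (hn p hp), Pi.single_eq_same, mul_one, mul_comm]
    · intro k _ hk
      rw [hu' _ _ (hn p hp), Pi.single_eq_of_ne hk.symm, mul_zero, mul_zero]
    · exact fun hp' => absurd (Finset.mem_range.mpr (hn p hp)) hp'
  let F : MvPolynomial (ℕ × ℕ) A := ∑ t ∈ q.support,
    monomial t (algebraMap ℂ A (coeff t q) * d ^ t.degree)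
  have hF : F = 0 := by
    refine eq_zero_of_forall_eval_algebraMap F fun α => ?_
    rw [← hzero α, MvPolynomial.aeval_def, MvPolynomial.eval₂_eq, map_sum]
    refine Finset.sum_congr rfl fun t _ => ?_
    rw [eval_monomial, Finsupp.prod]
    simp_rw [mul_pow]
    rw [Finset.prod_mul_distrib, Finset.prod_pow_eq_pow_sum, Finsupp.degree_apply, mul_assoc]
  have h2 := congrArg (coeff s) hF
  simp only [F, coeff_sum, coeff_monomial, coeff_zero, Finset.sum_ite_eq',
    MvPolynomial.mem_support_iff, ne_eq, hs, not_false_eq_true, if_true] at h2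
  have h3 := congrArg (fun a => algebraMap ℂ A (coeff s q)⁻¹ * a) h2
  simp only [← mul_assoc, ← map_mul, inv_mul_cancel₀ hs, map_one, one_mul, mul_zero] at h3
  rw [pow_succ, pow_mul, ← hd, h3, zero_mul]

end Jets

/-! ### Polarization -/

theorem mul_mul_pow_eq_zero {A : Type*} [CommRing A] [Algebra ℂ A] (V : Submodule ℂ A) (a : A)
    (k : ℕ) (h : ∀ y ∈ V, a * y ^ (k + 1) = 0) {x y : A} (hx : x ∈ V) (hy : y ∈ V) :
    a * x * y ^ k = 0 := by
  -- The linear coefficient of `t` in `a * (y + t x) ^ (k + 1)`, a polynomial that vanishes.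
  have hF : (C a * (C y + X () * C x) ^ (k + 1) : MvPolynomial Unit A) = 0 := by
    refine eq_zero_of_forall_eval_algebraMap _ fun α => ?_
    simp only [map_mul, map_pow, map_add, eval_C, eval_X]
    rw [← Algebra.smul_def]
    exact h _ (V.add_mem hy (V.smul_mem _ hx))
  have h1 := congrArg (fun F => MvPolynomial.eval (fun _ => (0 : A)) (pderiv () F)) hF
  simp only [Derivation.leibniz, Derivation.leibniz_pow, map_add, pderiv_C, pderiv_X_self,
    smul_eq_mul, map_mul, map_nsmul, eval_C, eval_X, map_pow, map_zero, map_one] at h1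
  simp only [mul_zero, zero_add, add_zero, zero_mul, mul_one, nsmul_eq_mul, Nat.cast_add,
    Nat.cast_one, add_tsub_cancel_right] at h1
  have h2 := congrArg (fun b => algebraMap ℂ A ((k : ℂ) + 1)⁻¹ * b) h1
  have hinv : algebraMap ℂ A ((k : ℂ) + 1)⁻¹ * ((k : A) + 1) = 1 := by
    rw [← map_natCast (algebraMap ℂ A), ← map_one (algebraMap ℂ A), ← map_add, ← map_mul,
      inv_mul_cancel₀ (Nat.cast_add_one_ne_zero k)]
  simp only [mul_zero] at h2
  linear_combination h2 - a * x * y ^ k * hinv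

/-- If all elements of a complex subspace have vanishing `m`-th power, then so do all products of
`m` elements. -/
theorem prod_eq_zero_of_forall_pow_eq_zero {A : Type*} [CommRing A] [Algebra ℂ A]
    (V : Submodule ℂ A) (m : ℕ) (h : ∀ y ∈ V, y ^ m = 0) (x : ℕ → A) (hx : ∀ i, x i ∈ V) :
    ∏ i ∈ Finset.range m, x i = 0 := by
  suffices ∀ j ≤ m, ∀ y ∈ V, (∏ i ∈ Finset.range j, x i) * y ^ (m - j) = 0 by
    simpa using this m le_rfl 0 V.zero_mem
  intro j
  induction j with
  | zero => simpa using h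
  | succ j ih =>
    intro hj y hy
    rw [Finset.prod_range_succ]
    refine mul_mul_pow_eq_zero V _ _ (fun z hz => ?_) (hx j) hy
    rw [show m - (j + 1) + 1 = m - j by omega]
    exact ih (by omega) z hz

/-! ### Differential polynomials -/

/-- The ring of differential polynomials in countably many variables. The variable `(i, k)` stands
for the `k`-th derivative of the `i`-th variable. -/
abbrev DiffPoly : Type := MvPolynomial (ℕ × ℕ) ℂ

/-- The derivation of differential polynomials. -/
noncomputable def DiffPoly.deriv : Derivation ℂ DiffPoly DiffPoly :=
  mkDerivation ℂ fun p => X (p.1, p.2 + 1)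

noncomputable instance : UnitalTransposedPoisson DiffPoly where
  br := LinearMap.mk₂ ℂ (fun x y => DiffPoly.deriv x * y - x * DiffPoly.deriv y)
    (fun a b c => by simp only [map_add]; ring)
    (fun r a b => by simp only [Derivation.map_smul, smul_mul_assoc, smul_sub])
    (fun a b c => by simp only [map_add]; ring)
    (fun r a b => by simp only [Derivation.map_smul, mul_smul_comm, smul_sub])
  br_self x := by simp only [LinearMap.mk₂_apply]; ring
  jacobi x y z := by
    simp only [LinearMap.mk₂_apply, map_sub, Derivation.leibniz, smul_eq_mul]
    ring
  transposed_leibniz x y z := by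
    simp only [LinearMap.mk₂_apply, Derivation.leibniz, smul_eq_mul]
    ring

theorem DiffPoly.D_eq (x : DiffPoly) : D x = DiffPoly.deriv x := by
  change DiffPoly.deriv x * 1 - x * DiffPoly.deriv 1 = _
  simp

/-- The homomorphism from the free algebra to differential polynomials. -/
noncomputable def toDiffPoly : Poly →ₐ[ℂ] DiffPoly :=
  Free.eval fun i => X (i, 0)

section

variable {A : Type*} [CommRing A] [Algebra ℂ A] [UnitalTransposedPoisson A]

theorem eval_D (v : ℕ → A) (p : Poly) : Free.eval v (D p) = D (Free.eval v p) := by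
  rw [D_apply, D_apply, Free.eval_br, map_one]

theorem aeval_deriv (v : ℕ → A) (q : DiffPoly) :
    aeval (fun p : ℕ × ℕ => D^[p.2] (v p.1)) (DiffPoly.deriv q)
      = D (aeval (fun p : ℕ × ℕ => D^[p.2] (v p.1)) q) := by
  induction q using MvPolynomial.induction_on with
  | C a => simp [DiffPoly.deriv]
  | add p q hp hq => simp only [map_add, hp, hq]
  | mul_X p i hp =>
    simp only [Derivation.leibniz, smul_eq_mul, map_add, map_mul, hp, aeval_X]
    simp only [DiffPoly.deriv, mkDerivation_X, aeval_X, Function.iterate_succ_apply']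

/-- Evaluation in `A` factors through differential polynomials. -/
theorem aeval_toDiffPoly (v : ℕ → A) (p : Poly) :
    aeval (fun p : ℕ × ℕ => D^[p.2] (v p.1)) (toDiffPoly p) = Free.eval v p := by
  have := Free.eval_unique v
    ((aeval (fun p : ℕ × ℕ => D^[p.2] (v p.1))).comp toDiffPoly)
    (fun p q => by
      simp only [AlgHom.comp_apply, toDiffPoly, Free.eval_br]
      rw [br_eq, br_eq, DiffPoly.D_eq, DiffPoly.D_eq, map_sub, map_mul, map_mul, aeval_deriv,
        aeval_deriv])
    (fun i => by simp [toDiffPoly, Free.eval_var])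
  rw [← this]
  rfl

/-- The factorization of evaluation, applied to the identity of the free algebra, provides
a left inverse. -/
theorem toDiffPoly_injective : Function.Injective toDiffPoly := by
  intro p q h
  have hid : (AlgHom.id ℂ Poly) = Free.eval Free.var :=
    Free.eval_unique _ _ (fun _ _ => rfl) (fun _ => rfl)
  have h1 := congrArg (aeval fun p : ℕ × ℕ => D^[p.2] (Free.var p.1 : Poly)) h
  rwa [aeval_toDiffPoly, aeval_toDiffPoly, ← hid] at h1

/-! ### The two polynomials -/

theorem br_mul_add_br_mul (x y z : A) : br (x * y) z + br (x * z) y = 2 * (D x * (y * z)) := by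
  simp only [br_eq, Derivation.leibniz, smul_eq_mul]
  ring

/-- By commutativity, all permutations contribute the same product. -/
theorem polyG_eq (m : ℕ) (c : Equiv.Perm (Fin m) → ℂ) :
    polyG m c = (∑ σ, c σ) • ∏ k : Fin m, D (Free.var (k : ℕ) : Poly) := by
  rw [polyG, Finset.sum_smul]
  refine Finset.sum_congr rfl fun σ _ => ?_
  rw [Equiv.prod_comp σ fun k : Fin m => D (Free.var (k : ℕ) : Poly)]

theorem polyF_eq (m : ℕ) (c : Equiv.Perm (Fin m) → ℂ) :
    polyF m c = polyG m c * ∏ k : Fin m,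
      (2 * (Free.var (m + 2 * (k : ℕ)) * Free.var (m + 2 * (k : ℕ) + 1)) : Poly) := by
  rw [polyF, polyG, Finset.sum_mul]
  refine Finset.sum_congr rfl fun σ _ => ?_
  rw [smul_mul_assoc, ← Finset.prod_mul_distrib]
  congr 1
  refine Finset.prod_congr rfl fun k _ => ?_
  rw [br_mul_add_br_mul]
  ring

theorem polyF_ne_zero_and_polyG_ne_zero (m : ℕ) (c : Equiv.Perm (Fin m) → ℂ)
    (hc : ∑ σ, c σ ≠ 0) : polyG m c ≠ 0 ∧ polyF m c ≠ 0 := by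
  have hvar (i : ℕ) : toDiffPoly (Free.var i) = X (i, 0) := Free.eval_var _ i
  have hD (i : ℕ) : toDiffPoly (D (Free.var i)) = X (i, 1) := by
    rw [toDiffPoly, eval_D, Free.eval_var, DiffPoly.D_eq, DiffPoly.deriv, mkDerivation_X]
  have hG : toDiffPoly (polyG m c) ≠ 0 := by
    rw [polyG_eq, map_smul, map_prod]
    refine smul_ne_zero hc (Finset.prod_ne_zero_iff.mpr fun k _ => ?_)
    rw [hD]
    exact X_ne_zero _
  have hF : toDiffPoly (polyF m c) ≠ 0 := by
    rw [polyF_eq, map_mul, map_prod]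
    refine mul_ne_zero hG (Finset.prod_ne_zero_iff.mpr fun k _ => ?_)
    rw [map_mul, map_mul, hvar, hvar, map_ofNat]
    exact mul_ne_zero two_ne_zero (mul_ne_zero (X_ne_zero _) (X_ne_zero _))
  exact ⟨fun h => hG (by rw [h, map_zero]), fun h => hF (by rw [h, map_zero])⟩

end

end UnitalTransposedPoisson

theorem mainTheorem6 (A : Type*) [CommRing A] [Algebra ℂ A] [UnitalTransposedPoisson A]
    (hA : ∃ p : UnitalTransposedPoisson.Poly,
      UnitalTransposedPoisson.IsPolynomialIdentity A p) :
    ∃ (m : ℕ) (c : Equiv.Perm (Fin m) → ℂ), 0 < m ∧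
      UnitalTransposedPoisson.IsPolynomialIdentity A (UnitalTransposedPoisson.polyG m c) ∧
      UnitalTransposedPoisson.IsPolynomialIdentity A (UnitalTransposedPoisson.polyF m c) := by
  open UnitalTransposedPoisson in
  obtain ⟨p, hp0, hp⟩ := hA
  obtain ⟨m, hm, hpow⟩ := exists_forall_pow_eq_zero (D : Derivation ℂ A A) (toDiffPoly p)
    (fun h => hp0 (toDiffPoly_injective (h.trans (map_zero _).symm)))
    (fun v => (aeval_toDiffPoly v p).trans (hp v))
  have hG : ∀ (c : Equiv.Perm (Fin m) → ℂ) (v : ℕ → A), Free.eval v (polyG m c) = 0 := by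
    intro c v
    have h0 := prod_eq_zero_of_forall_pow_eq_zero
      (LinearMap.range (D : Derivation ℂ A A).toLinearMap) m
      (by rintro _ ⟨y, rfl⟩; exact hpow y) (fun i => D (v i)) (fun i => ⟨v i, rfl⟩)
    rw [polyG_eq, map_smul, map_prod]
    simp_rw [eval_D, Free.eval_var]
    rw [Fin.prod_univ_eq_prod_range (fun i => D (v i)) m, h0, smul_zero]
  -- Only the sum of the coefficients matters, so the identity permutation alone suffices.
  have hne := polyF_ne_zero_and_polyG_ne_zero m (Pi.single 1 1) (by simp)
  refine ⟨m, Pi.single 1 1, hm, ⟨hne.1, hG _⟩, ⟨hne.2, fun v => ?_⟩⟩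
  rw [polyF_eq, map_mul, hG, zero_mul]
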